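/- For non-negative integers $h,i,j,k,l$ let $$I(h,i,j,k,l)=\int_0^1\!\!\int_0^1\frac{x^h(1-x)^iy^k(1-y)^j}{(1-xy)^{i+j-l+1}}\,dx\,dy ,$$ and let ${}_3F_2[a,b,c;d,e]=\sum_{n\ge0}\frac{(a)_n(b)_n(c)_n}{n!\,(d)_n(e)_n}$ (argument $1$). The integral $I(h,i,j,k,l)$ has the associated series $$F(h,i,j,k,l)={}_3F_2[h+1,k+1,i+j-l+1;\,h+i+2,k+j+2]$$ and the associated factor $g(h,i,j,k,l)=\frac{h!\,i!\,j!\,k!}{(h+i+1)!\,(k+j+1)!}$. On the ten symbols $h,i,j,k,l,\ j+k-h,\ k+l-i,\ l+h-j,\ h+i-k,\ i+j-l$ consider the permutations $\sigma=(h\;k)(i\;j)$ and $\tau=(h\;i\;j\;k\;l)$, extended by linearity, and $\varphi=(h\;\,i+j-l)(i\;\,l+h-j)(j+k-h\;\,k+l-i)$; put $\mathbf T=\langle\sigma,\tau\rangle$ and $\mathbf\Phi=\langle\varphi,\sigma,\tau\rangle$. The Rhin–Viola conjecture states, for non-negative integers $h,\dots,l,h',\dots,l'$: (i) if $I(h,i,j,k,l)=I(h',i',j',k',l')$,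 then some $\rho\in\mathbf T$ satisfies $\rho(h)=h',\dots,\rho(l)=l'$; (ii) if the five numbers $j+k-h,\ k+l-i,\ l+h-j,\ h+i-k,\ i+j-l$ and the five analogous primed numbers are all non-negative and $I(h,i,j,k,l)/I(h',i',j',k',l')\in\mathbf Q$, then some $\rho\in\mathbf\Phi$ satisfies $\rho(h)=h',\dots,\rho(l)=l'$. **Theorem.** (1) Let $\alpha,\beta,\gamma\in\mathbf C$ with $\beta\ne1$, and put $X=\frac{\alpha(\alpha-\gamma+1)}{\beta-1}$. Suppose that $\Re(2-\beta+X)>0$, that $\alpha+1$ and $\gamma+X$ are not non-positive integers, and that $2\alpha+\alpha^2-\alpha\beta-\gamma-\alpha\gamma+\beta\gamma\neq0$. Then both series below converge absolutely and $${}_3F_2[\alpha,\beta,\gamma;\,\alpha+1,\gamma+X+1]=\frac{(\alpha-\beta+2)(\alpha+\alpha^2-\gamma-\alpha\gamma+\beta\gamma)}{(\alpha+1)(2\alpha+\alpha^2-\alpha\beta-\gamma-\alpha\gamma+\beta\gamma)}\;{}_3F_2[\alpha+1,\beta-1,\gamma;\,\alpha+2,\gamma+X].\qquad(*)$$ (2)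 Sato's relation $I(3,1,3,1,0)=\zeta(2)-\frac{29}{18}=I(3,2,1,2,0)$, where $\zeta(2)=\pi^2/6$, holds, and its equality of integrals is the specialization $(\alpha,\beta,\gamma)=(4,3,4)$ of $(*)$. (3) For every integer $\alpha\ge2$ the two integrals below converge, that on the right is positive, and $$I(\alpha^2-1,\alpha-1,\alpha^2-\alpha+1,\alpha-1,0)=(\alpha-1)\,I(\alpha^2-1,\alpha,\alpha^2-\alpha-1,\alpha,0).$$ This equation is the specialization $(\alpha^2,\alpha+1,\alpha^2)$ of $(*)$. No $\rho\in\mathbf\Phi$ carries the first five-tuple to the second, and the associated series of the two five-tuples are not linked by iterated application of Thomae's transformation $(a,b,c;d,e)\mapsto(a,d-b,d-c;d,d+e-b-c)$ and permutations of the upper and of the lower parameters. The equation is a counterexample to part (ii) of the Rhin–Viola conjecture; for $\alpha=2$ it is Sato's relation and is also a counterexample to part (i). (4) As $\alpha\to\infty$ both integrals in (3) tend to $0$; the values $I(\alpha^2-1,\alpha-1,\alpha^2-\alpha+1,\alpha-1,0)$, $\alpha\ge2$, form an infinite set, and there are infinitely many counterexamples to part (ii). In (2) and (3), that $I(v)=c\,I(w)$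 is "the specialization at a triple" of $(*)$ means: the triple satisfies the hypotheses of (1); up to permutations of the upper and of the lower parameters, the right-hand series of $(*)$ is $F(v)$ and the left-hand series is $F(w)$; $I(v)=g(v)F(v)$ and $I(w)=g(w)F(w)$; and $g(v)=c\,g(w)\,r$, with $r$ the rational factor in $(*)$. -/

import Mathlib

open MeasureTheory Filter Topology

noncomputable section

/-! ### The Rhin--Viola integrals -/

/-- A five-tuple `(h, i, j, k, l)` of non-negative integers. -/
structure RVParams where
  h : ℕ
  i : ℕ
  j : ℕ
  k : ℕ
  l : ℕ

/-- The integrand `x^h (1-x)^i y^k (1-y)^j / (1-xy)^(i+j-l+1)`; the last exponent is an integer. -/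
def rvIntegrand (v : RVParams) (p : ℝ × ℝ) : ℝ :=
  p.1 ^ v.h * (1 - p.1) ^ v.i * p.2 ^ v.k * (1 - p.2) ^ v.j /
    (1 - p.1 * p.2) ^ ((v.i : ℤ) + v.j - v.l + 1)

/-- The unit square. -/
def unitSquare : Set (ℝ × ℝ) := Set.Icc (0 : ℝ) 1 ×ˢ Set.Icc (0 : ℝ) 1

/-- The integral `I(h,i,j,k,l)` over the unit square. -/
def rvI (v : RVParams) : ℝ := ∫ p in unitSquare, rvIntegrand v p

/-! ### The groups acting on the ten symbols

The ten symbols `h, i, j, k, l, j+k-h, k+l-i, l+h-j, h+i-k, i+j-l` are numbered, in this order,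
from `0` to `9`. -/

/-- The values of the ten symbols at a given five-tuple. -/
def rvValue (v : RVParams) : Fin 10 → ℤ :=
  ![v.h, v.i, v.j, v.k, v.l,
    (v.j : ℤ) + v.k - v.h, (v.k : ℤ) + v.l - v.i, (v.l : ℤ) + v.h - v.j,
    (v.h : ℤ) + v.i - v.k, (v.i : ℤ) + v.j - v.l]

/-- `σ = (h k)(i j)`, extended by linearity to the ten symbols. -/
def rvSigma : Equiv.Perm (Fin 10) :=
  Equiv.swap 0 3 * Equiv.swap 1 2 * Equiv.swap 5 8 * Equiv.swap 6 7

/-- `τ = (h i j k l)`, extended by linearity to the ten symbols. -/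
def rvTau : Equiv.Perm (Fin 10) :=
  List.formPerm [0, 1, 2, 3, 4] * List.formPerm [5, 6, 7, 8, 9]

/-- `φ = (h  i+j-l)(i  l+h-j)(j+k-h  k+l-i)`. -/
def rvPhi : Equiv.Perm (Fin 10) :=
  Equiv.swap 0 9 * Equiv.swap 1 7 * Equiv.swap 5 6

/-- The group `T = ⟨σ, τ⟩`. -/
def rvGroupT : Subgroup (Equiv.Perm (Fin 10)) := Subgroup.closure {rvSigma, rvTau}

/-- The group `Φ = ⟨φ, σ, τ⟩`. -/
def rvGroupPhi : Subgroup (Equiv.Perm (Fin 10)) := Subgroup.closure {rvPhi, rvSigma, rvTau}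

/-- `ρ(h) = h'`, `ρ(i) = i'`, `ρ(j) = j'`, `ρ(k) = k'` and `ρ(l) = l'`, the symbols `ρ(h)`, … being
evaluated at `v = (h,i,j,k,l)`, and `w = (h',i',j',k',l')`. -/
def rvSends (ρ : Equiv.Perm (Fin 10)) (v w : RVParams) : Prop :=
  rvValue v (ρ 0) = w.h ∧ rvValue v (ρ 1) = w.i ∧ rvValue v (ρ 2) = w.j ∧
    rvValue v (ρ 3) = w.k ∧ rvValue v (ρ 4) = w.l

/-! ### The two parts of the Rhin--Viola conjecture -/

/-- What part (i) of the conjecture predicts for the pair `(v, w)`. -/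
def rvCaseI (v w : RVParams) : Prop :=
  rvI v = rvI w → ∃ ρ ∈ rvGroupT, rvSends ρ v w

/-- What part (ii) of the conjecture predicts for the pair `(v, w)`. -/
def rvCaseII (v w : RVParams) : Prop :=
  (∀ m, 0 ≤ rvValue v m) → (∀ m, 0 ≤ rvValue w m) →
    (∃ q : ℚ, rvI v / rvI w = (q : ℝ)) → ∃ ρ ∈ rvGroupPhi, rvSends ρ v w

/-! ### Hypergeometric series `₃F₂` at `1` -/

/-- The parameters `a, b, c; d, e` of a `₃F₂`-series. -/
structure HypParams where
  a : ℂ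
  b : ℂ
  c : ℂ
  d : ℂ
  e : ℂ

/-- The `n`-th term of the `₃F₂`-series with argument `1`. -/
def hypTerm (p : HypParams) (n : ℕ) : ℂ :=
  (ascPochhammer ℂ n).eval p.a * (ascPochhammer ℂ n).eval p.b * (ascPochhammer ℂ n).eval p.c /
    ((n.factorial : ℂ) * (ascPochhammer ℂ n).eval p.d * (ascPochhammer ℂ n).eval p.e)

/-- `₃F₂[a, b, c; d, e; 1]`. -/
def hyp3F2 (p : HypParams) : ℂ := ∑' n, hypTerm p n

/-- The parameters agree up to permutations of the upper and of the lower parameters. -/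
def trivialSymm (p q : HypParams) : Prop :=
  ({p.a, p.b, p.c} : Multiset ℂ) = {q.a, q.b, q.c} ∧ ({p.d, p.e} : Multiset ℂ) = {q.d, q.e}

/-- One step: a trivial symmetry, or Thomae's transformation
`(a, b, c; d, e) ↦ (a, d-b, d-c; d, d+e-b-c)`. -/
inductive ThomaeStep : HypParams → HypParams → Prop
  | symm (p q : HypParams) (hpq : trivialSymm p q) : ThomaeStep p q
  | thomae (p : HypParams) :
      ThomaeStep p ⟨p.a, p.d - p.b, p.d - p.c, p.d, p.d + p.e - p.b - p.c⟩

/-- The parameters are linked by iterated Thomae relations and trivial symmetries. -/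
def thomaeRelated (p q : HypParams) : Prop := Relation.EqvGen ThomaeStep p q

/-- The `₃F₂`-series `[h+1, k+1, i+j-l+1; h+i+2, k+j+2]` belonging to `I(h,i,j,k,l)`. -/
def rvSeries (v : RVParams) : HypParams where
  a := v.h + 1
  b := v.k + 1
  c := v.i + v.j - v.l + 1
  d := v.h + v.i + 2
  e := v.k + v.j + 2

/-- The factor `h! i! j! k! / ((h+i+1)! (k+j+1)!)` between `I(h,i,j,k,l)` and its series. -/
def rvFactor (v : RVParams) : ℂ :=
  (v.h.factorial * v.i.factorial * v.j.factorial * v.k.factorial : ℂ) /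
    ((v.h + v.i + 1).factorial * (v.k + v.j + 1).factorial : ℂ)

/-! ### The general hypergeometric identity -/

/-- The shift `α(α-γ+1)/(β-1)`. -/
def exoticShift (α β γ : ℂ) : ℂ := α * (α - γ + 1) / (β - 1)

/-- The parameters on the left-hand side of the identity. -/
def exoticLeft (α β γ : ℂ) : HypParams :=
  ⟨α, β, γ, α + 1, γ + exoticShift α β γ + 1⟩

/-- The parameters on the right-hand side of the identity. -/
def exoticRight (α β γ : ℂ) : HypParams :=
  ⟨α + 1, β - 1, γ, α + 2, γ + exoticShift α β γ⟩

/-- The rational factor on the right-hand side of the identity. -/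
def exoticCoeff (α β γ : ℂ) : ℂ :=
  (α - β + 2) * (α + α ^ 2 - γ - α * γ + β * γ) /
    ((α + 1) * (2 * α + α ^ 2 - α * β - γ - α * γ + β * γ))

/-- The conditions under which both sides of the identity make sense: no division by zero and
convergence (for both series, the sum of the lower parameters minus the sum of the upper ones is
`2 - β + α(α-γ+1)/(β-1)`). -/
def exoticAdmissible (α β γ : ℂ) : Prop :=
  β ≠ 1 ∧ 0 < (2 - β + exoticShift α β γ).re ∧
    (∀ n : ℕ, α + 1 ≠ -(n : ℂ)) ∧ (∀ n : ℕ, γ + exoticShift α β γ ≠ -(n : ℂ)) ∧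
    2 * α + α ^ 2 - α * β - γ - α * γ + β * γ ≠ 0

/-- The equation `I(v) = c * I(w)` is the specialization at `(α, β, γ)` of the identity
`₃F₂(exoticLeft) = exoticCoeff * ₃F₂(exoticRight)`: the triple is admissible, the right series is
that of `I(v)` and the left series that of `I(w)` (up to the trivial symmetries), each integral is
its factor times its series, and the factors turn the identity into `I(v) = c * I(w)`. -/
def isExoticSpecialization (α β γ : ℂ) (v w : RVParams) (c : ℂ) : Prop :=
  exoticAdmissible α β γ ∧
    trivialSymm (exoticRight α β γ) (rvSeries v) ∧ trivialSymm (exoticLeft α β γ) (rvSeries w) ∧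
    (rvI v : ℂ) = rvFactor v * hyp3F2 (rvSeries v) ∧
    (rvI w : ℂ) = rvFactor w * hyp3F2 (rvSeries w) ∧
    rvFactor v = c * rvFactor w * exoticCoeff α β γ

/-! ### The infinite family -/

/-- `(α²-1, α-1, α²-α+1, α-1, 0)`; used for `2 ≤ α`, where no subtraction truncates. -/
def familyLeft (α : ℕ) : RVParams := ⟨α ^ 2 - 1, α - 1, α ^ 2 - α + 1, α - 1, 0⟩

/-- `(α²-1, α, α²-α-1, α, 0)`; used for `2 ≤ α`, where no subtraction truncates. -/
def familyRight (α : ℕ) : RVParams := ⟨α ^ 2 - 1, α, α ^ 2 - α - 1, α, 0⟩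

end

/-! Put `b = β - 1` and `e = γ + X`. The choice of `X` says exactly that `(b - α)γ = eb - α(α + 1)`.
Both series in (*) have terms that are rational multiples, in `n`, of the same quantity `(b)_n (γ)_n
/ (n! (e)_n)`, and under this relation the difference of the left term and the scaled right term is
`G(n + 1) - G(n)` for an explicit `G` (`exoticAntidiff_sub`). Here `G(0) = 0`, and `G(n) → 0`
because the terms of a `₃F₂` at `1` are `O(n^(-1-s))` with `s` of positive real part
(`hypTerm_succ_isBigO`). Summing gives `exotic_identity`.

Integrals and series are tied by expanding a power of `1/(1 - xy)` and integrating termwise with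
Beta integrals (`hasSum_rvTerm`). This also yields positivity and integrability. The family then
follows from (*) by comparing factorials (`rvFactor_family`).

The negative statements are elementary. The entry `i = α` of the second tuple is not among the ten
values of the first, so no permutation of the symbols whatsoever works. Thomae's transformation
permutes the multiset `{d, e, s+a, s+b, s+c}`, which differs for the two series. Finally, positive
integrals tending to `0` take infinitely many values. -/

open Asymptotics

/-! ### Growth of rising factorials and convergence of `₃F₂` at `1` -/

lemma ascPochhammer_eval_ne_zero_of_forall {d : ℂ} (hd : ∀ n : ℕ, d ≠ -(n : ℂ)) (n : ℕ) :
    (ascPochhammer ℂ n).eval d ≠ 0 := by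
  induction n with
  | zero => simp
  | succ n ih =>
    rw [ascPochhammer_succ_eval]
    exact mul_ne_zero ih fun h => hd n (eq_neg_of_add_eq_zero_left h)

lemma ascPochhammer_eval_eq_prod_range (a : ℂ) (n : ℕ) :
    (ascPochhammer ℂ n).eval a = ∏ j ∈ Finset.range n, (a + j) := by
  induction n with
  | zero => simp
  | succ n ih => rw [ascPochhammer_succ_eval, ih, Finset.prod_range_succ]

/-- Euler's limit `GammaSeq a n → Γ(a)` thereby compares `(a)_{n+1}` with `n^a n!`. Its product has
`n + 1` factors, which is why the estimates below are indexed by `n + 1`. -/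
lemma gammaSeq_mul_ascPochhammer_eval {a : ℂ} {n : ℕ}
    (ha : (ascPochhammer ℂ (n + 1)).eval a ≠ 0) :
    Complex.GammaSeq a n * (ascPochhammer ℂ (n + 1)).eval a = (n : ℂ) ^ a * n.factorial := by
  rw [Complex.GammaSeq, ← ascPochhammer_eval_eq_prod_range, div_mul_cancel₀ _ ha]

lemma norm_natCast_cpow_mul_factorial {n : ℕ} (hn : 0 < n) (a : ℂ) :
    ‖(n : ℂ) ^ a * n.factorial‖ = (n : ℝ) ^ a.re * n.factorial := by
  rw [norm_mul, Complex.norm_natCast_cpow_of_pos hn, Complex.norm_natCast]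

/-- Upper bound for the rising factorial `(a)_{n+1}`. -/
lemma ascPochhammer_eval_isBigO (a : ℂ) :
    (fun n : ℕ => (ascPochhammer ℂ (n + 1)).eval a) =O[atTop]
      fun n : ℕ => (n : ℝ) ^ a.re * n.factorial := by
  by_cases ha : ∀ m : ℕ, a ≠ -(m : ℂ)
  · have hG : Tendsto (fun n => (Complex.GammaSeq a n)⁻¹) atTop (𝓝 (Complex.Gamma a)⁻¹) :=
      (Complex.GammaSeq_tendsto_Gamma a).inv₀ (Complex.Gamma_ne_zero ha)
    have h2 : (fun n : ℕ => (ascPochhammer ℂ (n + 1)).eval a) =O[atTop]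
        fun n : ℕ => (Complex.GammaSeq a n)⁻¹ * ((n : ℂ) ^ a * n.factorial) := by
      refine EventuallyEq.isBigO ?_
      filter_upwards [eventually_gt_atTop 0] with n hn
      have h0 := ascPochhammer_eval_ne_zero_of_forall ha (n + 1)
      have hne : Complex.GammaSeq a n ≠ 0 := by
        intro h
        have := gammaSeq_mul_ascPochhammer_eval h0
        rw [h, zero_mul] at this
        have hn' : (n : ℂ) ≠ 0 := by exact_mod_cast hn.ne'
        have : (n : ℂ) ^ a * n.factorial ≠ 0 := mul_ne_zero
          (by rw [Complex.cpow_def_of_ne_zero hn']; exact Complex.exp_ne_zero _)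
          (by exact_mod_cast n.factorial_ne_zero)
        simp_all
      rw [← gammaSeq_mul_ascPochhammer_eval h0, inv_mul_cancel_left₀ hne]
    refine h2.trans ?_
    refine ((hG.isBigO_one ℝ).mul (g₂ := fun n : ℕ => (n : ℝ) ^ a.re * n.factorial) ?_).trans
      (by simpa using isBigO_refl _ _)
    refine IsBigO.of_bound 1 ?_
    filter_upwards [eventually_gt_atTop 0] with n hn
    rw [norm_natCast_cpow_mul_factorial hn, one_mul, Real.norm_eq_abs]
    exact le_abs_self _
  -- At a non-positive integer the rising factorial is eventually zero, so the upper bound needs no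
  -- Gamma value.
  · push Not at ha
    obtain ⟨m, rfl⟩ := ha
    refine EventuallyEq.trans_isBigO (f₂ := fun _ => (0 : ℂ)) ?_ (isBigO_zero _ _)
    filter_upwards [eventually_ge_atTop m] with n hn
    rw [ascPochhammer_eval_eq_prod_range]
    exact Finset.prod_eq_zero (i := m) (by simp; omega) (by simp)

/-- Lower bound for the rising factorial `(d)_{n+1}`. -/
lemma isBigO_ascPochhammer_eval {d : ℂ} (hd : ∀ m : ℕ, d ≠ -(m : ℂ)) :
    (fun n : ℕ => (n : ℝ) ^ d.re * n.factorial) =O[atTop]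
      fun n : ℕ => (ascPochhammer ℂ (n + 1)).eval d := by
  have h1 := ((Complex.GammaSeq_tendsto_Gamma d).isBigO_one ℝ).mul
    (isBigO_refl (fun n : ℕ => (ascPochhammer ℂ (n + 1)).eval d) atTop).norm_right
  refine (IsBigO.of_bound 1 ?_).trans (h1.trans ?_)
  · filter_upwards [eventually_gt_atTop 0] with n hn
    rw [gammaSeq_mul_ascPochhammer_eval (ascPochhammer_eval_ne_zero_of_forall hd _),
      norm_natCast_cpow_mul_factorial hn, one_mul, Real.norm_eq_abs, abs_of_nonneg (by positivity)]
  · simpa using (isBigO_refl (fun n : ℕ => (ascPochhammer ℂ (n + 1)).eval d) atTop).norm_left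

/-- The terms of a `₃F₂`-series at `1` decay like `n ^ (-1 - s)`, where `s` is the sum of the lower
parameters minus the sum of the upper ones. -/
lemma hypTerm_succ_isBigO {p : HypParams} (hd : ∀ m : ℕ, p.d ≠ -(m : ℂ))
    (he : ∀ m : ℕ, p.e ≠ -(m : ℂ)) :
    (fun n : ℕ => hypTerm p (n + 1)) =O[atTop]
      fun n : ℕ => (n : ℝ) ^ (-1 - (p.d + p.e - p.a - p.b - p.c).re) := by
  have hnum := ((ascPochhammer_eval_isBigO p.a).mul (ascPochhammer_eval_isBigO p.b)).mul
    (ascPochhammer_eval_isBigO p.c)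
  have hfac : (fun n : ℕ => ((n : ℝ) * n.factorial)) =O[atTop]
      fun n : ℕ => (((n + 1).factorial : ℕ) : ℂ) := by
    refine IsBigO.of_bound 1 (Eventually.of_forall fun n => ?_)
    rw [Complex.norm_natCast, Real.norm_eq_abs, abs_of_nonneg (by positivity), one_mul]
    have : n * n.factorial ≤ (n + 1).factorial := by
      rw [Nat.factorial_succ]; gcongr; omega
    exact_mod_cast this
  have hden := (hfac.mul (isBigO_ascPochhammer_eval hd)).mul (isBigO_ascPochhammer_eval he)
  have hinv := hden.inv_rev (by
    filter_upwards [eventually_gt_atTop 0] with n hn h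
    exfalso
    have : (0 : ℝ) < n := by exact_mod_cast hn
    have h' : (0 : ℝ) < (n : ℝ) * n.factorial * ((n : ℝ) ^ p.d.re * n.factorial) *
      ((n : ℝ) ^ p.e.re * n.factorial) := by positivity
    exact h'.ne' h)
  refine (hnum.mul hinv).congr' (Eventually.of_forall fun n => ?_) ?_
  · simp only [hypTerm, div_eq_mul_inv]
  · filter_upwards [eventually_gt_atTop 0] with n hn
    have hn' : (0 : ℝ) < n := by exact_mod_cast hn
    have hf : (0 : ℝ) < n.factorial := by exact_mod_cast n.factorial_pos
    have : -1 - (p.d + p.e - p.a - p.b - p.c).re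
        = p.a.re + p.b.re + p.c.re - 1 - p.d.re - p.e.re := by
      simp; ring
    rw [this, Real.rpow_sub hn', Real.rpow_sub hn', Real.rpow_sub hn', Real.rpow_add hn',
      Real.rpow_add hn', Real.rpow_one]
    have := (Real.rpow_pos_of_pos hn' p.d.re).ne'
    have := (Real.rpow_pos_of_pos hn' p.e.re).ne'
    field_simp

/-- Absolute convergence of `₃F₂` at `1`. -/
lemma summable_hypTerm {p : HypParams} (hd : ∀ m : ℕ, p.d ≠ -(m : ℂ))
    (he : ∀ m : ℕ, p.e ≠ -(m : ℂ)) (hs : 0 < (p.d + p.e - p.a - p.b - p.c).re) :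
    Summable (hypTerm p) :=
  (summable_nat_add_iff 1).1 <| summable_of_isBigO_nat
    (Real.summable_nat_rpow.2 (by linarith)) (hypTerm_succ_isBigO hd he)

lemma tendsto_mul_hypTerm_succ {p : HypParams} (hd : ∀ m : ℕ, p.d ≠ -(m : ℂ))
    (he : ∀ m : ℕ, p.e ≠ -(m : ℂ)) (hs : 0 < (p.d + p.e - p.a - p.b - p.c).re) :
    Tendsto (fun n : ℕ => (n : ℂ) * hypTerm p (n + 1)) atTop (𝓝 0) := by
  have h1 : (fun n : ℕ => (n : ℂ)) =O[atTop] fun n : ℕ => (n : ℝ) :=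
    IsBigO.of_bound 1 (Eventually.of_forall fun n => by simp)
  refine (h1.mul (hypTerm_succ_isBigO hd he)).trans_tendsto ?_
  refine ((tendsto_rpow_neg_atTop hs).comp tendsto_natCast_atTop_atTop).congr' ?_
  filter_upwards [eventually_gt_atTop 0] with n hn
  have hn' : (0 : ℝ) < n := by exact_mod_cast hn
  rw [Function.comp_apply, ← Real.rpow_one_add' hn'.le (by linarith)]
  congr 1; ring

/-! ### The telescoping identity -/

lemma ascPochhammer_eval_mul_add_natCast (a : ℂ) (n : ℕ) :
    a * (ascPochhammer ℂ n).eval (a + 1) = (ascPochhammer ℂ n).eval a * (a + n) := by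
  rw [← ascPochhammer_succ_eval, ascPochhammer_succ_left]
  simp

lemma tendsto_natCast_div_add_natCast (a : ℂ) :
    Tendsto (fun n : ℕ => (a + 1 + n) / (a + n)) atTop (𝓝 1) := by
  have h : Tendsto (fun n : ℕ => (a + n)⁻¹) atTop (𝓝 0) :=
    tendsto_inv₀_cobounded.comp
      ((tendsto_const_add_cobounded a).comp tendsto_natCast_atTop_cobounded)
  have h2 : Tendsto (fun n : ℕ => 1 + (a + n)⁻¹) atTop (𝓝 1) := by simpa using h.const_add 1
  refine h2.congr' ?_
  filter_upwards [eventually_gt_atTop ⌈‖a‖⌉₊] with n hn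
  have hne : a + n ≠ 0 := fun h0 => by
    have : ‖a‖ = n := by rw [eq_neg_of_add_eq_zero_left h0, norm_neg, Complex.norm_natCast]
    exact absurd (Nat.lt_of_ceil_lt hn) (by rw [this]; exact lt_irrefl _)
  field_simp
  ring

/-- This is the telescoping relation divided by the common factor `(b)_n (γ)_n / (n! (e)_n)`. -/
lemma exotic_rational_identity {α b γ e n : ℂ} (hγ : (b - α) * γ = e * b - α * (α + 1))
    (hb : b ≠ 0) (he : e - α ≠ 0) (hen : e + n ≠ 0) (hα : α + n ≠ 0) (hα1 : α + 1 + n ≠ 0) :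
    α / (α + n) * ((b + n) / b) * (e / (e + n)) -
        (α + 1 - b) * e / ((e - α) * (α + 1 + n)) =
      (b - α) * e / (b * (e - α)) *
        ((b + n) * (γ + n) / ((α + 1 + n) * (e + n)) - n / (α + n)) := by
  -- Here `γ` occurs only through `(b - α)γ`, so `hγ` eliminates it without dividing by `b - α`,
  -- which may vanish.
  have h : (b - α) * e / (b * (e - α)) *
        ((b + n) * (γ + n) / ((α + 1 + n) * (e + n)) - n / (α + n)) =
      e / (b * (e - α)) * ((b + n) * (((b - α) * γ) + (b - α) * n) / ((α + 1 + n) * (e + n)) -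
        (b - α) * n / (α + n)) := by ring
  rw [h, hγ]
  field_simp
  ring

/-- The antidifference that telescopes the difference of the two series. -/
noncomputable def exoticAntidiff (α β γ : ℂ) (n : ℕ) : ℂ :=
  (β - 1 - α) * (γ + exoticShift α β γ) /
      (2 * α + α ^ 2 - α * β - γ - α * γ + β * γ) * n / (α + n) *
    ((ascPochhammer ℂ n).eval (β - 1) * (ascPochhammer ℂ n).eval γ /
      (n.factorial * (ascPochhammer ℂ n).eval (γ + exoticShift α β γ)))

lemma exoticAntidiff_sub {α β γ : ℂ} (h : exoticAdmissible α β γ) (n : ℕ) :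
    hypTerm (exoticLeft α β γ) n - exoticCoeff α β γ * hypTerm (exoticRight α β γ) n =
      exoticAntidiff α β γ (n + 1) - exoticAntidiff α β γ n := by
  obtain ⟨hβ, -, hα, he, hD⟩ := h
  have hb : β - 1 ≠ 0 := sub_ne_zero.2 hβ
  have hX : (γ + exoticShift α β γ - γ) * (β - 1) = α * (α - γ + 1) := by
    rw [exoticShift]; field_simp; ring
  have hα1 : α + 1 + n ≠ 0 := fun h => hα n (eq_neg_of_add_eq_zero_left h)
  have hα0 : α + 1 ≠ 0 := by simpa using hα 0
  simp only [hypTerm, exoticLeft, exoticRight, exoticCoeff, exoticAntidiff]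
  generalize γ + exoticShift α β γ = e at *
  obtain ⟨b, rfl⟩ : ∃ b, β = b + 1 := ⟨β - 1, by ring⟩
  rw [add_sub_cancel_right] at *
  -- The two quadratic expressions in the coefficient of (*) factor as `b(e - α)` and `be`.
  have hD' : 2 * α + α ^ 2 - α * (b + 1) - γ - α * γ + (b + 1) * γ = b * (e - α) := by
    linear_combination -hX
  have hN' : α + α ^ 2 - γ - α * γ + (b + 1) * γ = b * e := by linear_combination -hX
  rw [hD'] at hD ⊢
  rw [hN']
  have heα : e - α ≠ 0 := right_ne_zero_of_mul hD
  have hen : e + n ≠ 0 := fun h => he n (eq_neg_of_add_eq_zero_left h)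
  have he0 : e ≠ 0 := by simpa using he 0
  have hP := ascPochhammer_eval_ne_zero_of_forall he n
  have hA := ascPochhammer_eval_ne_zero_of_forall hα n
  have hn1 : ((n : ℂ) + 1) ≠ 0 := by exact_mod_cast n.succ_ne_zero
  have hf : (n.factorial : ℂ) ≠ 0 := by exact_mod_cast n.factorial_ne_zero
  have e1 : (ascPochhammer ℂ n).eval (b + 1) = (ascPochhammer ℂ n).eval b * (b + n) / b := by
    rw [eq_div_iff hb, ← ascPochhammer_eval_mul_add_natCast]; ring
  have e2 : (ascPochhammer ℂ n).eval (e + 1) = (ascPochhammer ℂ n).eval e * (e + n) / e := by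
    rw [eq_div_iff he0, ← ascPochhammer_eval_mul_add_natCast]; ring
  have e3 : (ascPochhammer ℂ n).eval (α + 2) =
      (ascPochhammer ℂ n).eval (α + 1) * (α + 1 + n) / (α + 1) := by
    rw [eq_div_iff hα0, ← ascPochhammer_eval_mul_add_natCast, add_assoc α 1 1, one_add_one_eq_two]
    ring
  rw [e1, e2, e3]
  simp only [ascPochhammer_succ_eval, Nat.factorial_succ, Nat.cast_mul, Nat.cast_add, Nat.cast_one]
  -- This forces `n = 0` and `α = 0`. There `(α)_n = α (α+1)_n / (α+n)` fails, and `n/(α+n)` is `0/0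
  -- = 0` by convention, so the case is checked directly.
  by_cases hαn : α + n = 0
  · obtain rfl : n = 0 := by
      cases n with
      | zero => rfl
      | succ m =>
        refine absurd ?_ (hα m)
        push_cast at hαn
        linear_combination hαn
    obtain rfl : α = 0 := by simpa using hαn
    have : e = γ := by simpa [sub_eq_zero, hb] using hX
    subst this
    simp
    field_simp
    ring
  · have e4 : (ascPochhammer ℂ n).eval α =
        α * (ascPochhammer ℂ n).eval (α + 1) / (α + n) := by
      rw [eq_div_iff hαn, ascPochhammer_eval_mul_add_natCast]
    have key := exotic_rational_identity (γ := γ) (n := (n : ℂ)) (by linear_combination -hX) hb heα hen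
      hαn hα1
    rw [e4]
    generalize (ascPochhammer ℂ n).eval b = B at *
    generalize (ascPochhammer ℂ n).eval γ = C at *
    generalize (ascPochhammer ℂ n).eval e = E at *
    generalize (ascPochhammer ℂ n).eval (α + 1) = A at *
    have key' := congrArg (fun z => z * (B * C / (n.factorial * E))) key
    beta_reduce at key'
    have hα1' : α + (n + 1) ≠ 0 := by rwa [add_comm (n : ℂ) 1, ← add_assoc]
    convert key' using 1
    · field_simp
      ring
    · field_simp
      ring

/-- Up to a constant, the antidifference is `n` times the `n`-th right-hand term times
`(α+1+n)/(α+n)`. -/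
lemma tendsto_exoticAntidiff {α β γ : ℂ} (h : exoticAdmissible α β γ)
    (hlim : Tendsto (fun n : ℕ => (n : ℂ) * hypTerm (exoticRight α β γ) (n + 1)) atTop (𝓝 0))
    (hlim' : Tendsto (hypTerm (exoticRight α β γ)) atTop (𝓝 0)) :
    Tendsto (exoticAntidiff α β γ) atTop (𝓝 0) := by
  obtain ⟨-, -, hα, -, -⟩ := h
  have hα0 : α + 1 ≠ 0 := by simpa using hα 0
  have h1 : Tendsto (fun n : ℕ => (n : ℂ) * hypTerm (exoticRight α β γ) n) atTop (𝓝 0) := by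
    rw [← tendsto_add_atTop_iff_nat 1]
    have := hlim.add ((tendsto_add_atTop_iff_nat 1).2 hlim')
    rw [add_zero] at this
    refine this.congr fun n => ?_
    push_cast
    ring
  have h2 := (h1.mul (tendsto_natCast_div_add_natCast α)).const_mul
    ((β - 1 - α) * (γ + exoticShift α β γ) /
      (2 * α + α ^ 2 - α * β - γ - α * γ + β * γ) / (α + 1))
  rw [zero_mul, mul_zero] at h2
  refine h2.congr fun n => ?_
  have hα1 : α + 1 + n ≠ 0 := fun h => hα n (eq_neg_of_add_eq_zero_left h)
  have hA := ascPochhammer_eval_ne_zero_of_forall hα n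
  have e3 : (ascPochhammer ℂ n).eval (α + 2) =
      (ascPochhammer ℂ n).eval (α + 1) * (α + 1 + n) / (α + 1) := by
    rw [eq_div_iff hα0, ← ascPochhammer_eval_mul_add_natCast, add_assoc α 1 1, one_add_one_eq_two]
    ring
  simp only [hypTerm, exoticRight, exoticAntidiff, e3]
  generalize (β - 1 - α) * (γ + exoticShift α β γ) /
      (2 * α + α ^ 2 - α * β - γ - α * γ + β * γ) = K
  field_simp

lemma exotic_identity {α β γ : ℂ} (h : exoticAdmissible α β γ) :
    Summable (hypTerm (exoticLeft α β γ)) ∧ Summable (hypTerm (exoticRight α β γ)) ∧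
      hyp3F2 (exoticLeft α β γ) = exoticCoeff α β γ * hyp3F2 (exoticRight α β γ) := by
  have h' := h
  obtain ⟨-, hre, hα, he, -⟩ := h'
  have hα2 : ∀ n : ℕ, α + 2 ≠ -(n : ℂ) := fun n hn => hα (n + 1) (by
    push_cast; linear_combination hn)
  have he1 : ∀ n : ℕ, γ + exoticShift α β γ + 1 ≠ -(n : ℂ) := fun n hn => he (n + 1) (by
    push_cast; linear_combination hn)
  have hsL : 0 < ((exoticLeft α β γ).d + (exoticLeft α β γ).e - (exoticLeft α β γ).a -
      (exoticLeft α β γ).b - (exoticLeft α β γ).c).re := by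
    convert hre using 2
    simp only [exoticLeft]; ring
  have hsR : 0 < ((exoticRight α β γ).d + (exoticRight α β γ).e - (exoticRight α β γ).a -
      (exoticRight α β γ).b - (exoticRight α β γ).c).re := by
    convert hre using 2
    simp only [exoticRight]; ring
  have hL : Summable (hypTerm (exoticLeft α β γ)) := summable_hypTerm hα he1 hsL
  have hR : Summable (hypTerm (exoticRight α β γ)) := summable_hypTerm hα2 he hsR
  refine ⟨hL, hR, ?_⟩
  have hG := tendsto_exoticAntidiff h (tendsto_mul_hypTerm_succ hα2 he hsR) hR.tendsto_atTop_zero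
  have hsum := (hL.hasSum.sub (hR.hasSum.mul_left (exoticCoeff α β γ))).tendsto_sum_nat
  simp only [exoticAntidiff_sub h, Finset.sum_range_sub] at hsum
  have h0 : exoticAntidiff α β γ 0 = 0 := by simp [exoticAntidiff]
  rw [h0] at hsum
  simp only [sub_zero] at hsum
  exact sub_eq_zero.1 (tendsto_nhds_unique hsum hG)

/-! ### Series expansion of the Rhin–Viola integrals -/

lemma setIntegral_pow_mul_one_sub_pow (a b : ℕ) :
    ∫ x in Set.Icc (0 : ℝ) 1, x ^ a * (1 - x) ^ b =
      (a.factorial * b.factorial : ℝ) / ((a + b + 1).factorial : ℝ) := by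
  rw [integral_Icc_eq_integral_Ioc, ← intervalIntegral.integral_of_le zero_le_one]
  have h := Complex.Gamma_mul_Gamma_eq_betaIntegral (s := (a : ℂ) + 1) (t := (b : ℂ) + 1)
    (by simp; positivity) (by simp; positivity)
  rw [show (a : ℂ) + 1 + (b + 1) = ((a + b + 1 : ℕ) : ℂ) + 1 by push_cast; ring,
    Complex.Gamma_nat_eq_factorial, Complex.Gamma_nat_eq_factorial,
    Complex.Gamma_nat_eq_factorial, Complex.betaIntegral] at h
  have h2 : (∫ x in (0 : ℝ)..1, (x : ℂ) ^ ((a : ℂ) + 1 - 1) * (1 - (x : ℂ)) ^ ((b : ℂ) + 1 - 1)) =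
      ((∫ x in (0 : ℝ)..1, x ^ a * (1 - x) ^ b : ℝ) : ℂ) := by
    rw [← intervalIntegral.integral_ofReal]
    congr 1
    ext x
    simp
  rw [h2] at h
  have hf : ((a + b + 1).factorial : ℝ) ≠ 0 := by exact_mod_cast Nat.factorial_ne_zero _
  rw [eq_div_iff hf, mul_comm]
  exact_mod_cast h.symm

lemma factorial_mul_ascPochhammer_eval (a n : ℕ) :
    (a.factorial : ℂ) * (ascPochhammer ℂ n).eval ((a : ℂ) + 1) = ((a + n).factorial : ℂ) := by
  have := ascPochhammer_nat_eq_natCast_ascFactorial ℂ (a + 1) n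
  push_cast at this
  rw [this, ← Nat.factorial_mul_ascFactorial]
  push_cast; rfl

/-- The summands in the expansion of `I(h,i,j,k,l)` in powers of `xy`. -/
noncomputable def rvTerm (v : RVParams) (n : ℕ) : ℝ :=
  ((n + (v.i + v.j - v.l)).choose (v.i + v.j - v.l) : ℝ) *
    (((v.h + n).factorial * v.i.factorial : ℝ) / ((v.h + n + v.i + 1).factorial : ℝ) *
    (((v.k + n).factorial * v.j.factorial : ℝ) / ((v.k + n + v.j + 1).factorial : ℝ)))

lemma rvTerm_pos (v : RVParams) (n : ℕ) : 0 < rvTerm v n := by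
  have := Nat.choose_pos (Nat.le_add_left (v.i + v.j - v.l) n)
  unfold rvTerm
  positivity

lemma ofReal_rvTerm {v : RVParams} (hv : v.l ≤ v.i + v.j) (n : ℕ) :
    (rvTerm v n : ℂ) = rvFactor v * hypTerm (rvSeries v) n := by
  obtain ⟨h, i, j, k, l⟩ := v
  simp only at hv
  obtain ⟨m, hm⟩ := Nat.exists_eq_add_of_le hv
  have hm' : i + j - l = m := by omega
  have hc : (i : ℂ) + j - l + 1 = m + 1 := by
    have : (i : ℂ) + j = l + m := by exact_mod_cast hm
    rw [this]; ring
  simp only [rvTerm, rvFactor, hypTerm, rvSeries, hm', hc]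
  have f1 := factorial_mul_ascPochhammer_eval h n
  have f2 := factorial_mul_ascPochhammer_eval k n
  have f3 := factorial_mul_ascPochhammer_eval m n
  have f4 := factorial_mul_ascPochhammer_eval (h + i + 1) n
  have f5 := factorial_mul_ascPochhammer_eval (k + j + 1) n
  have f6' : ((n + m).choose m : ℂ) * m.factorial * n.factorial = (m + n).factorial := by
    have := Nat.add_choose_mul_factorial_mul_factorial n m
    rw [add_comm m n, ← this]
    push_cast
    ring
  rw [← f3] at f6'
  rw [show ((h + i + 1 : ℕ) : ℂ) + 1 = h + i + 2 by push_cast; ring,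
    show h + i + 1 + n = h + n + i + 1 by ring] at f4
  rw [show ((k + j + 1 : ℕ) : ℂ) + 1 = k + j + 2 by push_cast; ring,
    show k + j + 1 + n = k + n + j + 1 by ring] at f5
  have hfac : ∀ a : ℕ, (a.factorial : ℂ) ≠ 0 := fun a => by exact_mod_cast a.factorial_ne_zero
  have hc' : ((n + m).choose m : ℂ) = (ascPochhammer ℂ n).eval ((m : ℂ) + 1) / n.factorial := by
    rw [eq_div_iff (hfac n)]
    apply mul_left_cancel₀ (hfac m)
    rw [← f6']; ring
  have n4 : (ascPochhammer ℂ n).eval ((h : ℂ) + i + 2) ≠ 0 := fun h0 => by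
    rw [h0, mul_zero] at f4; exact hfac _ f4.symm
  have n5 : (ascPochhammer ℂ n).eval ((k : ℂ) + j + 2) ≠ 0 := fun h0 => by
    rw [h0, mul_zero] at f5; exact hfac _ f5.symm
  push_cast
  rw [hc', ← f1, ← f2, ← f4, ← f5]
  have := hfac n; have := hfac (h + i + 1); have := hfac (k + j + 1)
  field_simp

lemma summable_hypTerm_rvSeries (v : RVParams) : Summable (hypTerm (rvSeries v)) := by
  have hneg : ∀ a b m : ℕ, (a : ℂ) + b + 2 ≠ -(m : ℂ) := fun a b m h => by
    have h' : ((a + b + 2 + m : ℕ) : ℂ) = 0 := by push_cast; rw [h]; ring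
    exact absurd (Nat.cast_eq_zero.1 h') (by omega)
  refine summable_hypTerm (hneg v.h v.i) (hneg v.k v.j) ?_
  have : (rvSeries v).d + (rvSeries v).e - (rvSeries v).a - (rvSeries v).b - (rvSeries v).c
      = v.l + 1 := by
    simp only [rvSeries]; ring
  rw [this]
  simp; positivity

lemma summable_rvTerm {v : RVParams} (hv : v.l ≤ v.i + v.j) : Summable (rvTerm v) := by
  rw [← Complex.summable_ofReal]
  simpa only [ofReal_rvTerm hv] using (summable_hypTerm_rvSeries v).mul_left _

lemma tsum_expansion_eq_rvIntegrand {v : RVParams} (hv : v.l ≤ v.i + v.j) {p : ℝ × ℝ}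
    (hp : p ∈ unitSquare) (hp1 : p ≠ (1, 1)) :
    ∑' n : ℕ, ((n + (v.i + v.j - v.l)).choose (v.i + v.j - v.l) : ℝ) *
      ((p.1 ^ (v.h + n) * (1 - p.1) ^ v.i) * (p.2 ^ (v.k + n) * (1 - p.2) ^ v.j)) =
      rvIntegrand v p := by
  obtain ⟨x, y⟩ := p
  obtain ⟨⟨hx0, hx1⟩, hy0, hy1⟩ := hp
  simp only at hx0 hx1 hy0 hy1
  have hxy : x * y < 1 := by
    rcases hx1.lt_or_eq with h | rfl
    · nlinarith
    · rcases hy1.lt_or_eq with h | rfl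
      · simpa using h
      · exact absurd rfl hp1
  have hr : ‖x * y‖ < 1 := by rwa [Real.norm_eq_abs, abs_of_nonneg (mul_nonneg hx0 hy0)]
  have hs := (hasSum_choose_mul_geometric_of_norm_lt_one (v.i + v.j - v.l) hr).mul_left
    (x ^ v.h * (1 - x) ^ v.i * y ^ v.k * (1 - y) ^ v.j)
  have hexp : (v.i : ℤ) + v.j - v.l + 1 = ((v.i + v.j - v.l + 1 : ℕ) : ℤ) := by omega
  simp only [rvIntegrand, hexp, zpow_natCast]
  rw [div_eq_mul_one_div, ← hs.tsum_eq]
  congr 1 with n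
  rw [pow_add, pow_add, mul_pow]
  ring

lemma hasSum_rvTerm {v : RVParams} (hv : v.l ≤ v.i + v.j) : HasSum (rvTerm v) (rvI v) := by
  set F : ℕ → ℝ × ℝ → ℝ := fun n p =>
    ((n + (v.i + v.j - v.l)).choose (v.i + v.j - v.l) : ℝ) *
      ((p.1 ^ (v.h + n) * (1 - p.1) ^ v.i) * (p.2 ^ (v.k + n) * (1 - p.2) ^ v.j)) with hF
  have hms : MeasurableSet unitSquare := measurableSet_Icc.prod measurableSet_Icc
  have hval : ∀ n, ∫ p in unitSquare, F n p = rvTerm v n := fun n => by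
    simp only [hF]
    rw [integral_const_mul, unitSquare, Measure.volume_eq_prod,
      setIntegral_prod_mul (fun x : ℝ => x ^ (v.h + n) * (1 - x) ^ v.i)
        (fun y : ℝ => y ^ (v.k + n) * (1 - y) ^ v.j),
      setIntegral_pow_mul_one_sub_pow, setIntegral_pow_mul_one_sub_pow, rvTerm]
  have hint : ∀ n, IntegrableOn (F n) unitSquare := fun n => by
    refine ContinuousOn.integrableOn_compact (isCompact_Icc.prod isCompact_Icc) ?_
    exact Continuous.continuousOn (by fun_prop)
  have hnorm : ∀ n, ∫ p in unitSquare, ‖F n p‖ = rvTerm v n := fun n => by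
    rw [← hval]
    refine setIntegral_congr_fun hms fun p hp => ?_
    obtain ⟨⟨hx0, hx1⟩, hy0, hy1⟩ := hp
    have h1 := sub_nonneg.2 hx1
    have h2 := sub_nonneg.2 hy1
    refine Real.norm_of_nonneg ?_
    simp only [hF]
    positivity
  have h := hasSum_integral_of_summable_integral_norm (μ := volume.restrict unitSquare) hint
    (by simpa only [hnorm] using summable_rvTerm hv)
  simp only [hval] at h
  suffices hI : rvI v = ∫ p in unitSquare, ∑' n, F n p by rwa [hI]
  refine integral_congr_ae ?_
  -- The geometric expansion needs `xy < 1`, which fails in the square only at the corner, a null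
  -- set.
  have hne : ∀ᵐ p : ℝ × ℝ ∂(volume.restrict unitSquare), p ≠ (1, 1) :=
    ae_restrict_of_ae (compl_mem_ae_iff.2 (measure_singleton _))
  filter_upwards [hne, ae_restrict_mem hms] with p hp hps
  exact (tsum_expansion_eq_rvIntegrand hv hps hp).symm

lemma rvI_eq_factor_mul_hyp3F2 {v : RVParams} (hv : v.l ≤ v.i + v.j) :
    (rvI v : ℂ) = rvFactor v * hyp3F2 (rvSeries v) := by
  rw [hyp3F2, ← tsum_mul_left, ← (hasSum_rvTerm hv).tsum_eq, Complex.ofReal_tsum]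
  simp only [ofReal_rvTerm hv]

lemma rvI_pos {v : RVParams} (hv : v.l ≤ v.i + v.j) : 0 < rvI v := by
  rw [← (hasSum_rvTerm hv).tsum_eq]
  exact (summable_rvTerm hv).tsum_pos (fun n => (rvTerm_pos v n).le) 0 (rvTerm_pos v 0)

lemma integrableOn_rvIntegrand {v : RVParams} (hv : v.l ≤ v.i + v.j) :
    IntegrableOn (rvIntegrand v) unitSquare := by
  by_contra h
  -- A non-integrable function has integral `0` by convention, whereas the value given by the series
  -- is positive.
  exact (rvI_pos hv).ne' (integral_undef h)

/-! ### Upper bounds for `l = 0` -/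

/-- Since `1 - x` and `1 - y` are at most `1 - xy`, the powers in the numerator are absorbed by `(1
- xy)^(i+j)`. -/
lemma rvI_le_of_rvIntegrand_le {v : RVParams} (hv : v.l = 0) :
    rvI v ≤ rvI ⟨v.h, 0, 0, v.k, 0⟩ := by
  refine setIntegral_mono_on (integrableOn_rvIntegrand (by omega))
    (integrableOn_rvIntegrand (le_refl 0))
    (measurableSet_Icc.prod measurableSet_Icc) fun p hp => ?_
  obtain ⟨x, y⟩ := p
  obtain ⟨⟨hx0, hx1⟩, hy0, hy1⟩ := hp
  simp only at hx0 hx1 hy0 hy1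
  have hx : x * y ≤ x := by nlinarith
  have hy : x * y ≤ y := by nlinarith
  have hexp : (v.i : ℤ) + v.j - v.l + 1 = ((v.i + v.j + 1 : ℕ) : ℤ) := by omega
  simp only [rvIntegrand, hexp, zpow_natCast]
  simp only [pow_zero, mul_one, Nat.cast_zero, add_zero, sub_zero, zero_add, zpow_one]
  rcases (hx.trans hx1).lt_or_eq with hlt | heq
  · have h0 : 0 < 1 - x * y := by linarith
    rw [div_le_div_iff₀ (by positivity) h0, pow_succ, ← mul_assoc, pow_add]
    refine mul_le_mul_of_nonneg_right ?_ h0.le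
    have a1 : (1 - x) ^ v.i ≤ (1 - x * y) ^ v.i := pow_le_pow_left₀ (by linarith) (by linarith) _
    have a2 : (1 - y) ^ v.j ≤ (1 - x * y) ^ v.j := pow_le_pow_left₀ (by linarith) (by linarith) _
    calc x ^ v.h * (1 - x) ^ v.i * y ^ v.k * (1 - y) ^ v.j
        = x ^ v.h * y ^ v.k * ((1 - x) ^ v.i * (1 - y) ^ v.j) := by ring
      _ ≤ x ^ v.h * y ^ v.k * ((1 - x * y) ^ v.i * (1 - x * y) ^ v.j) := by
        refine mul_le_mul_of_nonneg_left (mul_le_mul a1 a2 ?_ ?_) (by positivity)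
        · exact pow_nonneg (by linarith) _
        · positivity
  -- At the corner both denominators vanish and both quotients are `0` by convention.
  · simp [heq]

/-- The majorant expands as the sum of `1/((h+n+1)(k+n+1))`, which for `h ≥ k` is dominated by the
telescoping sum of `1/((k+n)(k+n+1))`. -/
lemma rvI_le_inv {v : RVParams} (hv : v.l = 0) (hk : 0 < v.k) (hkh : v.k ≤ v.h) :
    rvI v ≤ (v.k : ℝ)⁻¹ := by
  refine (rvI_le_of_rvIntegrand_le hv).trans ?_
  have hk' : (0 : ℝ) < v.k := by exact_mod_cast hk
  have hkh' : (v.k : ℝ) ≤ v.h := by exact_mod_cast hkh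
  have hlim : Tendsto (fun n : ℕ => ((v.k : ℝ) + n)⁻¹) atTop (𝓝 0) :=
    tendsto_inv_atTop_zero.comp
      (tendsto_atTop_add_const_left _ _ tendsto_natCast_atTop_atTop)
  refine le_of_tendsto' (hasSum_rvTerm (le_refl 0)).tendsto_sum_nat fun N => ?_
  suffices h : ∑ n ∈ Finset.range N, rvTerm ⟨v.h, 0, 0, v.k, 0⟩ n ≤
      (v.k : ℝ)⁻¹ - ((v.k : ℝ) + N)⁻¹ by
    have : 0 ≤ ((v.k : ℝ) + N)⁻¹ := by positivity
    linarith
  induction N with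
  | zero => simp
  | succ N ih =>
    rw [Finset.sum_range_succ]
    have hterm : rvTerm ⟨v.h, 0, 0, v.k, 0⟩ N = 1 / (((v.h : ℝ) + N + 1) * ((v.k : ℝ) + N + 1)) := by
      simp only [rvTerm, Nat.factorial_succ, add_zero]
      have := Nat.factorial_ne_zero (v.h + N)
      have := Nat.factorial_ne_zero (v.k + N)
      push_cast
      simp
      field_simp
    have hle : rvTerm ⟨v.h, 0, 0, v.k, 0⟩ N ≤ 1 / (((v.k : ℝ) + N) * ((v.k : ℝ) + N + 1)) := by
      rw [hterm]
      refine one_div_le_one_div_of_le (by positivity) ?_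
      exact mul_le_mul_of_nonneg_right (by linarith) (by positivity)
    have : 1 / (((v.k : ℝ) + N) * ((v.k : ℝ) + N + 1)) =
        ((v.k : ℝ) + N)⁻¹ - ((v.k : ℝ) + (N + 1 : ℕ))⁻¹ := by
      push_cast
      field_simp
      ring
    linarith

/-! ### An invariant of Thomae's transformation -/

/-- The multiset `{d, e, s + a, s + b, s + c}`, where `s = d + e - a - b - c`. -/
noncomputable def thomaeInvariant (p : HypParams) : Multiset ℂ :=
  {p.d, p.e} + ({p.a, p.b, p.c} : Multiset ℂ).map
    fun z => ({p.d, p.e} : Multiset ℂ).sum - ({p.a, p.b, p.c} : Multiset ℂ).sum + z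

/-- Under Thomae's transformation the new `e` is `s + a` and the new `s + a` is the old `e`.
Moreover `s + b` and `s + c` are exchanged and `d` is fixed. -/
lemma ThomaeStep.invariant_eq {p q : HypParams} (h : ThomaeStep p q) :
    thomaeInvariant p = thomaeInvariant q := by
  induction h with
  | symm q hpq => rw [thomaeInvariant, thomaeInvariant, hpq.1, hpq.2]
  | thomae =>
    obtain ⟨a, b, c, d, e⟩ := p
    simp only [thomaeInvariant, Multiset.insert_eq_cons, Multiset.map_cons,
      Multiset.map_singleton, Multiset.sum_cons, Multiset.sum_singleton, Multiset.cons_add,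
      Multiset.singleton_add]
    rw [show d + e - (a + (b + c)) + a = d + e - b - c by ring,
      show d + (d + e - b - c) - (a + (d - b + (d - c))) + a = e by ring,
      show d + (d + e - b - c) - (a + (d - b + (d - c))) + (d - b) =
        d + e - (a + (b + c)) + c by ring,
      show d + (d + e - b - c) - (a + (d - b + (d - c))) + (d - c) =
        d + e - (a + (b + c)) + b by ring]
    generalize d + e - b - c = u
    generalize d + e - (a + (b + c)) + b = v
    generalize d + e - (a + (b + c)) + c = w
    congr 1
    rw [Multiset.cons_swap]
    congr 2
    exact Multiset.cons_swap _ _ _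

lemma thomaeRelated.invariant_eq {p q : HypParams} (h : thomaeRelated p q) :
    thomaeInvariant p = thomaeInvariant q := by
  induction h with
  | rel _ _ h => exact h.invariant_eq
  | refl => rfl
  | symm _ _ _ ih => exact ih.symm
  | trans _ _ _ _ _ ih1 ih2 => exact ih1.trans ih2

/-! ### The infinite family -/

lemma rvSeries_familyLeft {n : ℕ} (hn : 1 ≤ n) :
    rvSeries (familyLeft n) = ⟨(n : ℂ) ^ 2, n, (n : ℂ) ^ 2 + 1, (n : ℂ) ^ 2 + n, (n : ℂ) ^ 2 + 2⟩ := by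
  have h1 : n ≤ n ^ 2 := Nat.le_self_pow two_ne_zero n
  have h2 : 1 ≤ n ^ 2 := hn.trans h1
  simp only [rvSeries, familyLeft, HypParams.mk.injEq]
  push_cast [h1, h2, hn]
  refine ⟨?_, ?_, ?_, ?_, ?_⟩ <;> ring

lemma rvSeries_familyRight {n : ℕ} (hn : 2 ≤ n) :
    rvSeries (familyRight n) =
      ⟨(n : ℂ) ^ 2, n + 1, (n : ℂ) ^ 2, (n : ℂ) ^ 2 + n + 1, (n : ℂ) ^ 2 + 1⟩ := by
  have h1 : n ≤ n ^ 2 := Nat.le_self_pow two_ne_zero n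
  have h2 : 1 ≤ n ^ 2 - n := by
    have : n * 2 ≤ n ^ 2 := by rw [sq]; gcongr
    omega
  have h3 : 1 ≤ n ^ 2 := by omega
  simp only [rvSeries, familyRight, HypParams.mk.injEq]
  push_cast [h1, h2, h3]
  refine ⟨by ring, trivial, by ring, by ring, by ring⟩

lemma not_thomaeRelated_family {n : ℕ} (hn : 2 ≤ n) :
    ¬ thomaeRelated (rvSeries (familyLeft n)) (rvSeries (familyRight n)) := by
  intro h
  have h := h.invariant_eq
  rw [rvSeries_familyLeft (by omega), rvSeries_familyRight hn] at h
  -- For both series `s = 1`. The separating entry is `s + b = n + 2` on the right; on the left the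
  -- entries are `n²+n`, `n²+2` (twice), `n²+1` and `n+1`.
  have hmem : ((n + 2 : ℕ) : ℂ) ∈ thomaeInvariant
      ⟨(n : ℂ) ^ 2, n + 1, (n : ℂ) ^ 2, (n : ℂ) ^ 2 + n + 1, (n : ℂ) ^ 2 + 1⟩ := by
    simp only [thomaeInvariant, Multiset.insert_eq_cons, Multiset.map_cons,
      Multiset.map_singleton, Multiset.sum_cons, Multiset.sum_singleton, Multiset.cons_add,
      Multiset.singleton_add, Multiset.mem_cons, Multiset.mem_singleton]
    right; right; right; left
    push_cast; ring
  rw [← h] at hmem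
  simp only [thomaeInvariant, Multiset.insert_eq_cons, Multiset.map_cons,
    Multiset.map_singleton, Multiset.sum_cons, Multiset.sum_singleton, Multiset.cons_add,
    Multiset.singleton_add, Multiset.mem_cons, Multiset.mem_singleton] at hmem
  have h4 : n * 2 ≤ n ^ 2 := by rw [sq]; gcongr
  rcases hmem with h | h | h | h | h
  · have : n + 2 = n ^ 2 + n := by exact_mod_cast h
    omega
  · have : n + 2 = n ^ 2 + 2 := by exact_mod_cast h
    omega
  · have : n + 2 = n ^ 2 + 1 := by
      have h : ((n + 2 : ℕ) : ℂ) = (n ^ 2 + 1 : ℕ) := by rw [h]; push_cast; ring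
      exact_mod_cast h
    have h6 : n * (n - 1) = 1 := by
      rw [Nat.mul_sub, mul_one, ← sq]; omega
    have := Nat.eq_one_of_mul_eq_one_right h6
    omega
  · have : n + 2 = n + 1 := by
      have h : ((n + 2 : ℕ) : ℂ) = (n + 1 : ℕ) := by rw [h]; push_cast; ring
      exact_mod_cast h
    omega
  · have : n + 2 = n ^ 2 + 2 := by
      have h : ((n + 2 : ℕ) : ℂ) = (n ^ 2 + 2 : ℕ) := by rw [h]; push_cast; ring
      exact_mod_cast h
    omega

lemma not_rvSends_family {n : ℕ} (hn : 2 ≤ n) (ρ : Equiv.Perm (Fin 10)) :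
    ¬ rvSends ρ (familyLeft n) (familyRight n) := by
  rintro ⟨-, h, -⟩
  have h1 : n * 2 ≤ n ^ 2 := by rw [sq]; gcongr
  -- Excludes the value `j = n² - n + 1` from being `n`, as `(n - 1)² ≠ 0`.
  have h2 : n ^ 2 + 1 ≠ n * 2 := fun h => by
    have : (n : ℤ) ^ 2 + 1 = n * 2 := by exact_mod_cast h
    nlinarith
  revert h
  generalize ρ 1 = m
  fin_cases m <;> simp [rvValue, familyLeft, familyRight] <;> omega

lemma rvValue_familyLeft_nonneg {n : ℕ} (hn : 2 ≤ n) (m : Fin 10) :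
    0 ≤ rvValue (familyLeft n) m := by
  have h1 : n * 2 ≤ n ^ 2 := by rw [sq]; gcongr
  fin_cases m <;> simp [rvValue, familyLeft] <;> omega

lemma rvValue_familyRight_nonneg {n : ℕ} (hn : 2 ≤ n) (m : Fin 10) :
    0 ≤ rvValue (familyRight n) m := by
  have h1 : n * 2 ≤ n ^ 2 := by rw [sq]; gcongr
  fin_cases m <;> simp [rvValue, familyRight] <;> omega

lemma exoticShift_family {a : ℂ} (ha : a ≠ 0) : exoticShift (a ^ 2) (a + 1) (a ^ 2) = a := by
  rw [exoticShift, sub_self, zero_add, mul_one, add_sub_cancel_right, sq, mul_div_cancel_right₀ _ ha]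

lemma exoticAdmissible_family {n : ℕ} (hn : 1 ≤ n) :
    exoticAdmissible ((n : ℂ) ^ 2) ((n : ℂ) + 1) ((n : ℂ) ^ 2) := by
  have h0 : (n : ℂ) ≠ 0 := by exact_mod_cast (by omega : n ≠ 0)
  rw [exoticAdmissible, exoticShift_family h0]
  refine ⟨by simpa using h0, ?_, fun m h => ?_, fun m h => ?_, ?_⟩
  · rw [show (2 : ℂ) - (n + 1) + n = 1 by ring]; simp
  · have : ((n ^ 2 + 1 + m : ℕ) : ℂ) = 0 := by push_cast; linear_combination h
    exact absurd (Nat.cast_eq_zero.1 this) (by omega)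
  · have : ((n ^ 2 + n + m : ℕ) : ℂ) = 0 := by push_cast; linear_combination h
    exact absurd (Nat.cast_eq_zero.1 this) (by omega)
  · rw [show (2 : ℂ) * n ^ 2 + (n ^ 2) ^ 2 - n ^ 2 * (n + 1) - n ^ 2 - n ^ 2 * n ^ 2 +
      (n + 1) * n ^ 2 = n ^ 2 by ring]
    exact pow_ne_zero _ h0

lemma rvFactor_family {n : ℕ} (hn : 2 ≤ n) :
    rvFactor (familyLeft n) = ((n : ℂ) - 1) * rvFactor (familyRight n) *
      exoticCoeff ((n : ℂ) ^ 2) ((n : ℂ) + 1) ((n : ℂ) ^ 2) := by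
  have h1 : n * 2 ≤ n ^ 2 := by rw [sq]; gcongr
  -- With `r = n - 1` and `s = n² - n - 1` the tuples involve no truncated subtraction, and the
  -- factorials reduce to a few common ones.
  obtain ⟨r, hr⟩ : ∃ r, n = r + 1 := ⟨n - 1, by omega⟩
  obtain ⟨s, hs⟩ : ∃ s, n ^ 2 = s + n + 1 := ⟨n ^ 2 - n - 1, by omega⟩
  have hL : familyLeft n = ⟨s + n, r, s + 1 + 1, r, 0⟩ := by
    simp only [familyLeft, RVParams.mk.injEq, and_true]
    generalize n ^ 2 = N at *
    omega
  have hR : familyRight n = ⟨s + n, r + 1, s, r + 1, 0⟩ := by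
    simp only [familyRight, RVParams.mk.injEq, and_true]
    generalize n ^ 2 = N at *
    omega
  have e2 : r + (s + 1 + 1) + 1 = s + n + 1 + 1 := by omega
  have e3 : s + n + (r + 1) + 1 = s + n + r + 1 + 1 := by omega
  have e4 : r + 1 + s + 1 = s + n + 1 := by omega
  rw [hL, hR, rvFactor, rvFactor]
  simp only [e2, e3, e4]
  simp only [Nat.factorial_succ (s + n + 1), Nat.factorial_succ (s + n + r + 1),
    Nat.factorial_succ (s + 1), Nat.factorial_succ s, Nat.factorial_succ r]
  have hn0 : (n : ℂ) ≠ 0 := by exact_mod_cast (by omega : n ≠ 0)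
  have hn1 : (n : ℂ) ^ 2 + 1 ≠ 0 := by exact_mod_cast (by omega : n ^ 2 + 1 ≠ 0)
  have hn2 : (n : ℂ) + 1 ≠ 0 := by exact_mod_cast (by omega : n + 1 ≠ 0)
  have hr' : (r : ℂ) = n - 1 := by rw [hr]; push_cast; ring
  have hs' : (s : ℂ) = n ^ 2 - n - 1 := by
    have : (n : ℂ) ^ 2 = s + n + 1 := by exact_mod_cast hs
    rw [this]; ring
  have hc : exoticCoeff ((n : ℂ) ^ 2) ((n : ℂ) + 1) ((n : ℂ) ^ 2) =
      ((n : ℂ) ^ 2 - n + 1) * (n + 1) / (n ^ 2 + 1) := by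
    rw [exoticCoeff, show (2 : ℂ) * n ^ 2 + (n ^ 2) ^ 2 - n ^ 2 * (n + 1) - n ^ 2 - n ^ 2 * n ^ 2 +
      (n + 1) * n ^ 2 = n ^ 2 by ring]
    field_simp
    ring
  rw [hc]
  have f1 : ((s + n).factorial : ℂ) ≠ 0 := by exact_mod_cast Nat.factorial_ne_zero _
  have f2 : ((s + n + r + 1).factorial : ℂ) ≠ 0 := by exact_mod_cast Nat.factorial_ne_zero _
  have f3 : ((s + n + 1).factorial : ℂ) ≠ 0 := by exact_mod_cast Nat.factorial_ne_zero _
  push_cast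
  generalize ((s + n).factorial : ℂ) = F1 at *
  generalize ((s + n + r + 1).factorial : ℂ) = F2 at *
  generalize ((s + n + 1).factorial : ℂ) = F3 at *
  rw [hr', hs']
  have g1 : (n : ℂ) ^ 2 - n - 1 + n + 1 + 1 = n ^ 2 + 1 := by ring
  have g2 : (n : ℂ) ^ 2 - n - 1 + n + (n - 1) + 1 + 1 = n * (n + 1) := by ring
  rw [g1, g2]
  field_simp
  ring

lemma isExoticSpecialization_family {n : ℕ} (hn : 2 ≤ n) :
    isExoticSpecialization ((n : ℂ) ^ 2) ((n : ℂ) + 1) ((n : ℂ) ^ 2)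
      (familyLeft n) (familyRight n) ((n : ℂ) - 1) := by
  have h0 : (n : ℂ) ≠ 0 := by exact_mod_cast (by omega : n ≠ 0)
  refine ⟨exoticAdmissible_family (by omega), ?_, ?_,
    rvI_eq_factor_mul_hyp3F2 (Nat.zero_le _), rvI_eq_factor_mul_hyp3F2 (Nat.zero_le _),
    rvFactor_family hn⟩
  · rw [rvSeries_familyLeft (by omega), trivialSymm, exoticRight, exoticShift_family h0]
    simp only [add_sub_cancel_right, Multiset.insert_eq_cons]
    constructor
    · rw [Multiset.cons_swap, ← Multiset.singleton_add, ← Multiset.singleton_add,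
        ← Multiset.singleton_add, ← Multiset.singleton_add]
      abel
    · exact Multiset.pair_comm _ _
  · rw [rvSeries_familyRight hn, trivialSymm, exoticLeft, exoticShift_family h0]
    exact ⟨rfl, Multiset.pair_comm _ _⟩

/-- Each term depends on the parameters only through products over the upper and lower multisets, so
(*) carries over to the permuted series. -/
lemma isExoticSpecialization.rvI_eq {α β γ c : ℂ} {v w : RVParams}
    (h : isExoticSpecialization α β γ v w c) : (rvI v : ℂ) = c * rvI w := by
  obtain ⟨hadm, hR, hL, hv, hw, hg⟩ := h
  have hsymm : ∀ {p q : HypParams}, trivialSymm p q → hyp3F2 p = hyp3F2 q := by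
    intro p q hpq
    unfold hyp3F2
    congr 1 with n
    have h1 := congrArg (fun s : Multiset ℂ => (s.map fun z => (ascPochhammer ℂ n).eval z).prod) hpq.1
    have h2 := congrArg (fun s : Multiset ℂ => (s.map fun z => (ascPochhammer ℂ n).eval z).prod) hpq.2
    simp only [Multiset.insert_eq_cons, Multiset.map_cons, Multiset.map_singleton,
      Multiset.prod_cons, Multiset.prod_singleton] at h1 h2
    rw [hypTerm, hypTerm, mul_assoc, mul_assoc, h1, mul_assoc, mul_assoc, h2]
  have := (exotic_identity hadm).2.2
  rw [hv, hw, hg, ← hsymm hR, ← hsymm hL, this]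
  ring

lemma rvI_family {n : ℕ} (hn : 2 ≤ n) :
    rvI (familyLeft n) = ((n : ℝ) - 1) * rvI (familyRight n) := by
  exact_mod_cast (isExoticSpecialization_family hn).rvI_eq

lemma not_rvCaseII_family {n : ℕ} (hn : 2 ≤ n) : ¬ rvCaseII (familyLeft n) (familyRight n) := by
  intro h
  obtain ⟨ρ, -, hρ⟩ := h (rvValue_familyLeft_nonneg hn) (rvValue_familyRight_nonneg hn)
    ⟨(n : ℚ) - 1, by
      have hpos : 0 < rvI (familyRight n) := rvI_pos (Nat.zero_le _)
      rw [rvI_family hn, mul_div_cancel_right₀ _ hpos.ne']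
      push_cast; rfl⟩
  exact not_rvSends_family hn ρ hρ

/-! ### Limits and infinitude -/

lemma tendsto_rvI_familyLeft : Tendsto (fun n : ℕ => rvI (familyLeft n)) atTop (𝓝 0) := by
  rw [← tendsto_add_atTop_iff_nat 2]
  have hlim : Tendsto (fun n : ℕ => ((n + 1 : ℕ) : ℝ)⁻¹) atTop (𝓝 0) :=
    (tendsto_inv_atTop_zero.comp tendsto_natCast_atTop_atTop).comp (tendsto_add_atTop_nat 1)
  refine squeeze_zero (fun n => (rvI_pos (Nat.zero_le _)).le) (fun n => ?_) hlim
  refine rvI_le_inv (v := familyLeft (n + 2)) rfl (Nat.succ_pos _) ?_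
  have : n + 2 ≤ (n + 2) ^ 2 := Nat.le_self_pow two_ne_zero _
  simp only [familyLeft]
  omega

lemma tendsto_rvI_familyRight : Tendsto (fun n : ℕ => rvI (familyRight n)) atTop (𝓝 0) := by
  rw [← tendsto_add_atTop_iff_nat 2]
  have hlim : Tendsto (fun n : ℕ => ((n + 2 : ℕ) : ℝ)⁻¹) atTop (𝓝 0) :=
    (tendsto_inv_atTop_zero.comp tendsto_natCast_atTop_atTop).comp (tendsto_add_atTop_nat 2)
  refine squeeze_zero (fun n => (rvI_pos (Nat.zero_le _)).le) (fun n => ?_) hlim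
  refine rvI_le_inv (v := familyRight (n + 2)) rfl (Nat.succ_pos _) ?_
  have : (n + 2) * 2 ≤ (n + 2) ^ 2 := by rw [sq]; gcongr; omega
  simp only [familyRight]
  omega

lemma infinite_rvI_familyLeft :
    ((fun n : ℕ => rvI (familyLeft n)) '' {n | 2 ≤ n}).Infinite := by
  intro hfin
  have hne : ((fun n : ℕ => rvI (familyLeft n)) '' {n | 2 ≤ n}).Nonempty :=
    ⟨_, 2, le_refl 2, rfl⟩
  -- A finite set of values would have a least element. It is positive, yet later integrals fall
  -- below it.
  obtain ⟨_, ⟨n, -, rfl⟩, hmin⟩ := Set.exists_min_image _ id hfin hne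
  have hpos : 0 < rvI (familyLeft n) := rvI_pos (Nat.zero_le _)
  obtain ⟨m, hm, hm2⟩ :=
    ((tendsto_rvI_familyLeft.eventually_lt_const hpos).and (eventually_ge_atTop 2)).exists
  exact absurd (hmin _ ⟨m, hm2, rfl⟩) (not_le.2 hm)

lemma infinite_not_rvCaseII : {p : RVParams × RVParams | ¬ rvCaseII p.1 p.2}.Infinite := by
  refine Set.infinite_of_injective_forall_mem
    (f := fun n : ℕ => (familyLeft (n + 2), familyRight (n + 2))) (fun a b h => ?_)
    fun n => not_rvCaseII_family (by omega)
  have : (familyRight (a + 2)).i = (familyRight (b + 2)).i := congrArg (fun p => p.2.i) h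
  simpa [familyRight] using this

/-! ### Sato's value -/

lemma rvI_sato : rvI ⟨3, 2, 1, 2, 0⟩ = Real.pi ^ 2 / 6 - 29 / 18 := by
  -- Removes the indices `0` to `3`, that is `1 + 1/4 + 1/9`; index `0` contributes `1/0 = 0`.
  have hz := ((hasSum_nat_add_iff' 4).2 hasSum_zeta_two).tendsto_sum_nat
  have hinv : ∀ c : ℝ, Tendsto (fun n : ℕ => ((n : ℝ) + c)⁻¹) atTop (𝓝 0) := fun c =>
    tendsto_inv_atTop_zero.comp
      (tendsto_atTop_add_const_right _ _ tendsto_natCast_atTop_atTop)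
  -- By partial fractions the `n`-th term is `1/(n+4)² - (7/3)/(n+4) + 4/(n+5) - (5/3)/(n+6)`. The
  -- last three pieces telescope because `4 = 7/3 + 5/3`, and `-1/4` makes the sum start at `0`.
  have hG : Tendsto (fun N : ℕ => -1 / 4 + 7 / 3 * ((N : ℝ) + 4)⁻¹ - 5 / 3 * ((N : ℝ) + 5)⁻¹)
      atTop (𝓝 (-1 / 4 + 7 / 3 * 0 - 5 / 3 * 0)) :=
    (((hinv 4).const_mul _).const_add _).sub ((hinv 5).const_mul _)
  have hterm : ∀ n : ℕ, rvTerm ⟨3, 2, 1, 2, 0⟩ n =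
      ((n : ℝ) + 1) * (n + 2) / (3 * (n + 4) ^ 2 * (n + 5) * (n + 6)) := fun n => by
    have hc : (((n + 3).choose 3 : ℕ) : ℝ) * 6 = (n + 3) * (n + 2) * (n + 1) := by
      have := Nat.descFactorial_eq_factorial_mul_choose (n + 3) 3
      simp [Nat.descFactorial, Nat.factorial] at this
      have h2 : (n + 3).choose 3 * 6 = (n + 3) * (n + 2) * (n + 1) := by linarith
      exact_mod_cast h2
    have hc' : (((n + 3).choose 3 : ℕ) : ℝ) = (n + 3) * (n + 2) * (n + 1) / 6 := by linarith
    simp only [rvTerm]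
    norm_num only
    rw [hc']
    have f := Nat.factorial_ne_zero n
    rw [show 3 + n + 2 + 1 = n + 6 by ring, show 2 + n + 1 + 1 = n + 4 by ring,
      show 3 + n = n + 3 by ring, show 2 + n = n + 2 by ring]
    simp only [Nat.factorial_succ]
    push_cast
    field_simp
    ring
  have hsum : ∀ N : ℕ, ∑ n ∈ Finset.range N, rvTerm ⟨3, 2, 1, 2, 0⟩ n =
      ∑ n ∈ Finset.range N, 1 / ((n + 4 : ℕ) : ℝ) ^ 2 +
        (-1 / 4 + 7 / 3 * ((N : ℝ) + 4)⁻¹ - 5 / 3 * ((N : ℝ) + 5)⁻¹) := fun N => by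
    induction N with
    | zero => norm_num
    | succ N ih =>
      rw [Finset.sum_range_succ, Finset.sum_range_succ, ih, hterm]
      push_cast
      field_simp
      ring
  have hlim := (hasSum_rvTerm (v := ⟨3, 2, 1, 2, 0⟩) (by norm_num)).tendsto_sum_nat
  rw [tendsto_nhds_unique hlim ((hz.add hG).congr fun N => (hsum N).symm)]
  norm_num [Finset.sum_range_succ]
  ring

theorem mainTheorem5 :
    -- the general hypergeometric identity
    (∀ α β γ : ℂ, exoticAdmissible α β γ →
      Summable (hypTerm (exoticLeft α β γ)) ∧ Summable (hypTerm (exoticRight α β γ)) ∧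
      hyp3F2 (exoticLeft α β γ) = exoticCoeff α β γ * hyp3F2 (exoticRight α β γ)) ∧
    -- Sato's counterexample is its specialization at (4, 3, 4)
    (rvI ⟨3, 1, 3, 1, 0⟩ = Real.pi ^ 2 / 6 - 29 / 18 ∧
      rvI ⟨3, 2, 1, 2, 0⟩ = Real.pi ^ 2 / 6 - 29 / 18 ∧
      isExoticSpecialization 4 3 4 ⟨3, 1, 3, 1, 0⟩ ⟨3, 2, 1, 2, 0⟩ 1) ∧
    -- the family: convergence, the identity, and failure of the prediction
    (∀ α : ℕ, 2 ≤ α →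
      IntegrableOn (rvIntegrand (familyLeft α)) unitSquare ∧
      IntegrableOn (rvIntegrand (familyRight α)) unitSquare ∧
      0 < rvI (familyRight α) ∧
      rvI (familyLeft α) = ((α : ℝ) - 1) * rvI (familyRight α) ∧
      isExoticSpecialization ((α : ℂ) ^ 2) ((α : ℂ) + 1) ((α : ℂ) ^ 2)
        (familyLeft α) (familyRight α) ((α : ℂ) - 1) ∧
      ¬ thomaeRelated (rvSeries (familyLeft α)) (rvSeries (familyRight α)) ∧
      (¬ ∃ ρ ∈ rvGroupPhi, rvSends ρ (familyLeft α) (familyRight α)) ∧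
      ¬ rvCaseII (familyLeft α) (familyRight α)) ∧
    -- the first member, which is Sato's, also contradicts part (i)
    (familyLeft 2 = ⟨3, 1, 3, 1, 0⟩ ∧ familyRight 2 = ⟨3, 2, 1, 2, 0⟩ ∧
      ¬ rvCaseI (familyLeft 2) (familyRight 2)) ∧
    -- the integrals tend to zero, and the counterexamples to part (ii) are infinitely many
    Tendsto (fun α : ℕ => rvI (familyLeft α)) atTop (𝓝 0) ∧
    Tendsto (fun α : ℕ => rvI (familyRight α)) atTop (𝓝 0) ∧
    ((fun α : ℕ => rvI (familyLeft α)) '' {α | 2 ≤ α}).Infinite ∧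
    {p : RVParams × RVParams | ¬ rvCaseII p.1 p.2}.Infinite := by
  have hL : familyLeft 2 = ⟨3, 1, 3, 1, 0⟩ := rfl
  have hR : familyRight 2 = ⟨3, 2, 1, 2, 0⟩ := rfl
  have hI : rvI (familyLeft 2) = rvI (familyRight 2) := by
    rw [rvI_family le_rfl]; norm_num
  refine ⟨fun α β γ h => exotic_identity h, ⟨?_, rvI_sato, ?_⟩, fun n hn => ?_, ⟨hL, hR, ?_⟩,
    tendsto_rvI_familyLeft, tendsto_rvI_familyRight, infinite_rvI_familyLeft,
    infinite_not_rvCaseII⟩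
  -- Only one of the two integrals is evaluated directly; the other equals it by the family at `α =
  -- 2`, where the factor `α - 1` is `1`.
  · rw [← hL, hI, hR, rvI_sato]
  · have := isExoticSpecialization_family (n := 2) le_rfl
    rw [hL, hR] at this
    norm_num at this
    exact this
  · refine ⟨integrableOn_rvIntegrand (Nat.zero_le _), integrableOn_rvIntegrand (Nat.zero_le _),
      rvI_pos (Nat.zero_le _), rvI_family hn, isExoticSpecialization_family hn,
      not_thomaeRelated_family hn, ?_, not_rvCaseII_family hn⟩
    rintro ⟨ρ, -, hρ⟩
    exact not_rvSends_family hn ρ hρ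
  · intro h
    obtain ⟨ρ, -, hρ⟩ := h hI
    exact not_rvSends_family le_rfl ρ hρ
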